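/- Let $(\Omega,\mathcal F,P)$ be a probability space. For a random variable $X$ with distribution function $F_X(x)=P(X\le x)$ and quantile function $F_X^{-1}(u)=\inf\{x: F_X(x)\ge u\}$, the conditional tail expectation is $$\mathrm{CTE}_\alpha(X)=\frac1{1-\alpha}\int_\alpha^1F_X^{-1}(p)\,dp\quad(0\le\alpha<1),\qquad \mathrm{CTE}_1(X)=\operatorname{ess\,sup}X .$$ Let $0\le\alpha<1$ and let $L$ be an integrable random variable. Then $$\mathrm{CTE}_\alpha(L)=\sup\{\mathbb E[LZ]:\ \mathbb EZ=1,\ 0\le Z,\ (1-\alpha)Z\le 1\}$$ $$\phantom{\mathrm{CTE}_\alpha(L)}=\sup\Big\{\mathbb E[LZ]:\ \mathbb EZ=1,\ 0\le Z,\ \mathrm{CTE}_p(Z)\le\tfrac1{1-\alpha}\text{ for all }p\in(\alpha,1]\Big\},$$ where $Z$ ranges over integrable random variables, the inequalities on $Z$ hold almost surely, and $LZ$ is integrable for every $Z$ in either set. -/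

import Mathlib

open MeasureTheory

namespace DistortedPremium

noncomputable section

/-- The cumulative distribution function `F_X(x) = P(X ≤ x)` of a real random variable. -/
def distFun {Ω : Type*} [MeasurableSpace Ω] (P : Measure Ω) (X : Ω → ℝ) (x : ℝ) : ℝ :=
  P.real {ω | X ω ≤ x}

/-- The quantile `F_X⁻¹(u) = inf {x : F_X(x) ≥ u}`. It is a genuine infimum for `0 < u < 1`;
the values at the endpoints are irrelevant, as quantiles are only integrated below. -/
def quantile {Ω : Type*} [MeasurableSpace Ω] (P : Measure Ω) (X : Ω → ℝ) (u : ℝ) : ℝ :=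
  sInf {x : ℝ | u ≤ distFun P X x}

/-- The conditional tail expectation at level `α ∈ [0, 1]`:
`(1 - α)⁻¹ ∫_α^1 F_X⁻¹(p) dp` for `α < 1`, and the (possibly infinite) essential supremum
of `X` for `α = 1`. -/
def cte {Ω : Type*} [MeasurableSpace Ω] (P : Measure Ω) (α : ℝ) (X : Ω → ℝ) : EReal :=
  if α < 1 then ((1 / (1 - α) * ∫ p in α..1, quantile P X p : ℝ) : EReal)
  else essSup (fun ω => (X ω : EReal)) P

/-- Dual variables `Z` with `E Z = 1`, `0 ≤ Z` and `(1 - α) Z ≤ 1` almost surely. -/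
def dualSet {Ω : Type*} [MeasurableSpace Ω] (P : Measure Ω) (α : ℝ) : Set (Ω → ℝ) :=
  {Z | Integrable Z P ∧ ∫ ω, Z ω ∂P = 1 ∧ (∀ᵐ ω ∂P, 0 ≤ Z ω) ∧ ∀ᵐ ω ∂P, (1 - α) * Z ω ≤ 1}

/-- Dual variables `Z` with `E Z = 1`, `0 ≤ Z` almost surely, and
`CTE_p(Z) ≤ 1 / (1 - α)` for all levels `p > α`. -/
def recursiveDualSet {Ω : Type*} [MeasurableSpace Ω] (P : Measure Ω) (α : ℝ) : Set (Ω → ℝ) :=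
  {Z | Integrable Z P ∧ ∫ ω, Z ω ∂P = 1 ∧ (∀ᵐ ω ∂P, 0 ≤ Z ω) ∧
    ∀ p : ℝ, α < p → p ≤ 1 → cte P p Z ≤ ((1 / (1 - α) : ℝ) : EReal)}

end

end DistortedPremium

namespace DistortedPremium

variable {Ω : Type*} [MeasurableSpace Ω] {P : Measure Ω} {X : Ω → ℝ}

/-! For `0 < α`, let `q` be the `α`-quantile of `L`; then CTE_α(L) = q + (1-α)⁻¹ E(L-q)⁺
(`cte_of_pos`). Every dual `Z` satisfies LZ ≤ qZ + (1-α)⁻¹(L-q)⁺ pointwise a.s., which gives the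
upper bound. Equality holds for Z = (1-α)⁻¹(1_{L>q} + c·1_{L=q}), where `c` splits the atom at `q`
so that EZ = 1; so the supremum is attained. The two dual sets coincide: a bound on `Z` bounds its
quantiles and hence every CTE, while level 1 returns the bound on the essential supremum. -/

lemma integrable_mul_of_mem_dualSet (hX : Integrable X P) {α : ℝ} (hα1 : α < 1) {Z : Ω → ℝ}
    (hZ : Z ∈ dualSet P α) : Integrable (fun ω ↦ X ω * Z ω) P := by
  obtain ⟨hi, -, h0, hM⟩ := hZ
  refine hX.mul_bdd (c := 1 / (1 - α)) hi.aestronglyMeasurable ?_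
  filter_upwards [h0, hM] with ω h0 hM
  rwa [Real.norm_of_nonneg h0, le_div_iff₀' (sub_pos.2 hα1)]

variable [IsProbabilityMeasure P]

lemma distFun_eq_cdf (hX : AEMeasurable X P) (x : ℝ) :
    distFun P X x = ProbabilityTheory.cdf (P.map X) x := by
  have := Measure.isProbabilityMeasure_map hX
  rw [ProbabilityTheory.cdf_eq_real, map_measureReal_apply_of_aemeasurable hX measurableSet_Iic]
  rfl

/-- Right continuity of the distribution function makes the infimum attained. Its limits at ±∞, with
`0 < u < 1`, keep the set nonempty and bounded below, so `sInf` takes no default value. -/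
lemma quantile_le_iff (hX : AEMeasurable X P) {u : ℝ} (hu : u ∈ Set.Ioo 0 1) (x : ℝ) :
    quantile P X u ≤ x ↔ u ≤ distFun P X x := by
  have e : distFun P X = ProbabilityTheory.cdf (P.map X) := funext (distFun_eq_cdf hX)
  have hbdd : BddBelow {y : ℝ | u ≤ distFun P X y} := by
    obtain ⟨b, hb⟩ := ((ProbabilityTheory.tendsto_cdf_atBot (P.map X)).eventually
      (gt_mem_nhds hu.1)).exists
    refine ⟨b, fun y hy ↦ ?_⟩
    by_contra! h
    have := ProbabilityTheory.monotone_cdf (P.map X) h.le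
    simp only [Set.mem_ofPred_eq, e] at hy
    linarith
  have hne : {y : ℝ | u ≤ distFun P X y}.Nonempty := by
    obtain ⟨b, hb⟩ := ((ProbabilityTheory.tendsto_cdf_atTop (P.map X)).eventually
      (lt_mem_nhds hu.2)).exists
    exact ⟨b, by simpa only [Set.mem_ofPred_eq, e] using hb.le⟩
  refine ⟨fun h ↦ ?_, fun h ↦ csInf_le hbdd h⟩
  have hlt : ∀ y, x < y → u ≤ distFun P X y := fun y hy ↦ by
    obtain ⟨z, hz, hzy⟩ := exists_lt_of_csInf_lt hne (h.trans_lt hy)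
    rw [e] at *
    exact le_trans hz (ProbabilityTheory.monotone_cdf _ hzy.le)
  have hr : Filter.Tendsto (distFun P X) (nhdsWithin x (Set.Ioi x)) (nhds (distFun P X x)) := by
    rw [e]
    exact ((ProbabilityTheory.cdf (P.map X)).right_continuous x).mono_left
      (nhdsWithin_mono _ Set.Ioi_subset_Ici_self)
  exact ge_of_tendsto hr (eventually_nhdsWithin_of_forall hlt)

lemma monotoneOn_quantile (hX : AEMeasurable X P) :
    MonotoneOn (quantile P X) (Set.Ioo 0 1) := fun _ hu _ hv huv ↦
  (quantile_le_iff hX hu _).2 (huv.trans ((quantile_le_iff hX hv _).1 le_rfl))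

lemma aemeasurable_quantile (hX : AEMeasurable X P) :
    AEMeasurable (quantile P X) (volume.restrict (Set.Ioo 0 1)) :=
  aemeasurable_restrict_of_monotoneOn measurableSet_Ioo (monotoneOn_quantile hX)

/-- The quantile function of a uniform variable has the law of `X`. -/
lemma map_quantile (hX : AEMeasurable X P) :
    (volume.restrict (Set.Ioo (0 : ℝ) 1)).map (quantile P X) = P.map X := by
  have hU : IsProbabilityMeasure (volume.restrict (Set.Ioo (0 : ℝ) 1)) := ⟨by simp⟩
  have := Measure.isProbabilityMeasure_map hX
  refine Measure.ext_of_Iic _ _ fun x ↦ ?_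
  rw [Measure.map_apply_of_aemeasurable (aemeasurable_quantile hX) measurableSet_Iic,
    Measure.restrict_apply₀' measurableSet_Ioo.nullMeasurableSet,
    Measure.map_apply_of_aemeasurable hX measurableSet_Iic]
  have hF : P (X ⁻¹' Set.Iic x) = ENNReal.ofReal (distFun P X x) := by
    rw [distFun, ofReal_measureReal]; rfl
  have h1 : distFun P X x ≤ 1 := measureReal_le_one
  have hs : quantile P X ⁻¹' Set.Iic x ∩ Set.Ioo 0 1 = Set.Ioc 0 (distFun P X x) ∩ Set.Iio 1 := by
    ext u
    constructor
    · rintro ⟨h, hu⟩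
      exact ⟨⟨hu.1, (quantile_le_iff hX hu x).1 h⟩, hu.2⟩
    · rintro ⟨h, hu⟩
      exact ⟨(quantile_le_iff hX ⟨h.1, hu⟩ x).2 h.2, h.1, hu⟩
  -- The point `u = 1` is lost only when F(x) = 1, and it is null.
  have hae : (Set.Ioc 0 (distFun P X x) ∩ Set.Iio 1 : Set ℝ) =ᵐ[volume]
      (Set.Ioc 0 (distFun P X x) ∩ Set.Iic 1 : Set ℝ) :=
    Filter.EventuallyEq.rfl.inter Iio_ae_eq_Iic
  rw [hs, measure_congr hae, Set.inter_eq_left.2 fun u hu ↦ hu.2.trans h1, Real.volume_Ioc,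
    sub_zero, hF]

lemma integral_comp_quantile (hX : AEMeasurable X P) {g : ℝ → ℝ} (hg : Measurable g) :
    ∫ u in Set.Ioo (0 : ℝ) 1, g (quantile P X u) = ∫ ω, g (X ω) ∂P := by
  rw [← integral_map hX hg.aestronglyMeasurable, ← map_quantile hX,
    integral_map (aemeasurable_quantile hX) hg.aestronglyMeasurable]

lemma integrableOn_quantile (hX : Integrable X P) :
    IntegrableOn (quantile P X) (Set.Ioo 0 1) := by
  have hm := hX.aemeasurable
  have : Integrable id ((volume.restrict (Set.Ioo (0 : ℝ) 1)).map (quantile P X)) := by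
    rw [map_quantile hm]
    exact (integrable_map_measure measurable_id.aestronglyMeasurable hm).2 hX
  exact (integrable_map_measure measurable_id.aestronglyMeasurable
    (aemeasurable_quantile hm)).1 this

lemma cte_zero (hX : Integrable X P) : cte P 0 X = ((∫ ω, X ω ∂P : ℝ) : EReal) := by
  rw [cte, if_pos one_pos, intervalIntegral.integral_of_le zero_le_one,
    integral_Ioc_eq_integral_Ioo, integral_comp_quantile hX.aemeasurable (g := fun x ↦ x) measurable_id]
  simp

/-- By monotonicity the quantile function is at most `q` before `α` and at least `q` after it, so
its excess over `q` lives on `(α, 1)`. -/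
lemma cte_of_pos (hX : Integrable X P) {α : ℝ} (hα : α ∈ Set.Ioo 0 1) :
    cte P α X = ((quantile P X α +
      (1 - α)⁻¹ * ∫ ω, max (X ω - quantile P X α) 0 ∂P : ℝ) : EReal) := by
  have hm := hX.aemeasurable
  set q := quantile P X α with hq
  have hi := integrableOn_quantile hX
  have hsub : Set.Ioo α 1 ⊆ Set.Ioo 0 1 := Set.Ioo_subset_Ioo_left hα.1.le
  have key : ∫ ω, max (X ω - q) 0 ∂P = ∫ p in Set.Ioo α 1, (quantile P X p - q) := by
    rw [← integral_comp_quantile hm (g := fun x ↦ max (x - q) 0) (by fun_prop)]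
    rw [setIntegral_eq_of_subset_of_forall_sdiff_eq_zero measurableSet_Ioo hsub]
    · refine setIntegral_congr_fun measurableSet_Ioo fun p hp ↦ ?_
      exact max_eq_left (sub_nonneg.2 (monotoneOn_quantile hm hα (hsub hp) hp.1.le))
    · rintro p ⟨hp, hp'⟩
      have : p ≤ α := by
        by_contra! h
        exact hp' ⟨h, hp.2⟩
      exact max_eq_right (sub_nonpos.2 (monotoneOn_quantile hm hp hα this))
  have h1 : 1 - α ≠ 0 := (sub_pos.2 hα.2).ne'
  rw [cte, if_pos hα.2, key, intervalIntegral.integral_of_le hα.2.le, integral_Ioc_eq_integral_Ioo,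
    integral_sub (hi.mono_set hsub) (integrable_const q)]
  simp only [integral_const, measureReal_restrict_apply_univ, Real.volume_real_Ioo_of_le hα.2.le,
    smul_eq_mul]
  congr 1
  field_simp
  ring

/-- Boundedness of `X` keeps the infimum genuine even at `u = 1`, an endpoint that the interval
integral bound includes. -/
lemma quantile_mem_Icc {M : ℝ} (h0 : ∀ᵐ ω ∂P, 0 ≤ X ω) (hM : ∀ᵐ ω ∂P, X ω ≤ M) {u : ℝ}
    (hu : u ∈ Set.Ioc 0 1) : quantile P X u ∈ Set.Icc 0 M := by
  have hneg : ∀ x ∈ {x : ℝ | u ≤ distFun P X x}, 0 ≤ x := fun x hx ↦ by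
    by_contra! h
    have : distFun P X x = 0 := by
      rw [distFun, measureReal_def, measure_eq_zero_iff_ae_notMem.2, ENNReal.toReal_zero]
      filter_upwards [h0] with ω hω hω'
      exact (h.trans_le hω).not_ge hω'
    exact (hu.1.trans_le hx).ne' this
  refine ⟨Real.sInf_nonneg hneg, csInf_le ⟨0, hneg⟩ ?_⟩
  have : distFun P X M = 1 := by
    rw [distFun, measureReal_def, measure_congr (Filter.eventuallyEq_univ.2 hM), measure_univ, ENNReal.toReal_one]
  exact hu.2.trans this.ge

lemma recursiveDualSet_eq_dualSet {α : ℝ} (hα0 : 0 ≤ α) (hα1 : α < 1) :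
    recursiveDualSet P α = dualSet P α := by
  have h1 : 0 < 1 - α := sub_pos.2 hα1
  have hiff (z : ℝ) : (1 - α) * z ≤ 1 ↔ z ≤ 1 / (1 - α) := by rw [le_div_iff₀' h1]
  ext Z
  simp only [recursiveDualSet, dualSet, Set.mem_ofPred_eq, hiff]
  refine and_congr_right fun _ ↦ and_congr_right fun _ ↦ and_congr_right fun h0 ↦ ⟨fun h ↦ ?_,
    fun h p hp hp1 ↦ ?_⟩
  · have := h 1 hα1 le_rfl
    rw [cte, if_neg (lt_irrefl _)] at this
    filter_upwards [ae_le_essSup (f := fun ω ↦ (Z ω : EReal)) (μ := P)] with ω hω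
    exact EReal.coe_le_coe_iff.1 (hω.trans this)
  · rw [cte]
    split_ifs with hlt
    · have hp0 : 0 < 1 - p := sub_pos.2 hlt
      have := intervalIntegral.norm_integral_le_of_norm_le_const (a := p) (b := 1)
        (f := quantile P Z) (C := 1 / (1 - α)) fun u hu ↦ by
          rw [Set.uIoc_of_le hp1] at hu
          have := quantile_mem_Icc h0 h ⟨(hα0.trans_lt hp).trans hu.1, hu.2⟩
          rw [Real.norm_of_nonneg this.1]
          exact this.2
      rw [abs_of_pos hp0] at this
      rw [EReal.coe_le_coe_iff, one_div_mul_eq_div, div_le_iff₀ hp0]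
      exact (Real.le_norm_self _).trans this
    · refine essSup_le_of_ae_le _ ?_
      filter_upwards [h] with ω hω
      exact EReal.coe_le_coe_iff.2 hω

lemma integral_mul_le_of_mem_dualSet (hX : Integrable X P) {α : ℝ} (hα1 : α < 1) {Z : Ω → ℝ}
    (hZ : Z ∈ dualSet P α) (q : ℝ) :
    ∫ ω, X ω * Z ω ∂P ≤ q + (1 - α)⁻¹ * ∫ ω, max (X ω - q) 0 ∂P := by
  have hXZ := integrable_mul_of_mem_dualSet hX hα1 hZ
  obtain ⟨hi, h1, h0, hM⟩ := hZ
  have hpos : 0 < 1 - α := sub_pos.2 hα1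
  have hmax : Integrable (fun ω ↦ max (X ω - q) 0) P := (hX.sub (integrable_const q)).pos_part
  have : ∫ ω, X ω * Z ω ∂P ≤ ∫ ω, (q * Z ω + (1 - α)⁻¹ * max (X ω - q) 0) ∂P := by
    refine integral_mono_ae hXZ ((hi.const_mul q).add (hmax.const_mul _)) ?_
    filter_upwards [h0, hM] with ω h0 hM
    have hz : Z ω ≤ (1 - α)⁻¹ := by rwa [← one_div, le_div_iff₀' hpos]
    have a1 : (X ω - q) * Z ω ≤ max (X ω - q) 0 * Z ω :=
      mul_le_mul_of_nonneg_right (le_max_left _ _) h0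
    have a2 : Z ω * max (X ω - q) 0 ≤ (1 - α)⁻¹ * max (X ω - q) 0 :=
      mul_le_mul_of_nonneg_right hz (le_max_right _ _)
    linarith
  rwa [integral_add (hi.const_mul q) (hmax.const_mul _), integral_const_mul, integral_const_mul,
    h1, mul_one] at this

/-- The tail mass `1 - α` is attained above the quantile once its atom is split suitably. -/
lemma exists_split_atom_quantile (hX : AEMeasurable X P) {α : ℝ} (hα : α ∈ Set.Ioo 0 1) :
    ∃ c ∈ Set.Icc (0 : ℝ) 1, (P.map X).real (Set.Ioi (quantile P X α)) +
      c * (P.map X).real {quantile P X α} = 1 - α := by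
  have := Measure.isProbabilityMeasure_map hX
  set q := quantile P X α
  set ν := P.map X
  have hF (x : ℝ) : distFun P X x = ν.real (Set.Iic x) := by
    rw [distFun_eq_cdf hX, ProbabilityTheory.cdf_eq_real]
  have hle : ν.real (Set.Ioi q) ≤ 1 - α := by
    have := (quantile_le_iff hX hα q).1 le_rfl
    rw [← Set.compl_Iic, probReal_compl_eq_one_sub measurableSet_Iic, ← hF]
    linarith
  have hIio : ν.real (Set.Iio q) ≤ α := by
    have hmono : Monotone fun n : ℕ ↦ Set.Iic (q - 1 / ((n : ℝ) + 1)) := fun m n hmn ↦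
      Set.Iic_subset_Iic.2 (sub_le_sub_left (Nat.one_div_le_one_div hmn) q)
    have hU : ⋃ n : ℕ, Set.Iic (q - 1 / ((n : ℝ) + 1)) = Set.Iio q := by
      ext x
      simp only [Set.mem_iUnion, Set.mem_Iic, Set.mem_Iio]
      constructor
      · rintro ⟨n, hn⟩
        have := Nat.one_div_pos_of_nat (α := ℝ) (n := n)
        linarith
      · intro hx
        obtain ⟨n, hn⟩ := exists_nat_one_div_lt (sub_pos.2 hx)
        exact ⟨n, by linarith⟩
    have ht := tendsto_measure_iUnion_atTop (μ := ν) hmono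
    rw [hU] at ht
    -- Each point below `q` has F < α; the limit from the left keeps only `≤`.
    refine le_of_tendsto ((ENNReal.tendsto_toReal (measure_ne_top _ _)).comp ht)
      (.of_forall fun n ↦ ?_)
    have hlt : q - 1 / ((n : ℝ) + 1) < q := by
      have := Nat.one_div_pos_of_nat (α := ℝ) (n := n)
      linarith
    have := mt (quantile_le_iff hX hα _).2 hlt.not_ge
    rw [hF] at this
    exact (not_le.1 this).le
  have hge : 1 - α ≤ ν.real (Set.Ioi q) + ν.real {q} := by
    have hIci : ν.real (Set.Ici q) = ν.real (Set.Ioi q) + ν.real {q} := by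
      rw [← Set.Ioi_union_left, measureReal_union (by simp) (measurableSet_singleton q)]
    rw [← hIci, ← Set.compl_Iio, probReal_compl_eq_one_sub measurableSet_Iio]
    linarith
  -- Without an atom the two bounds force the tail mass to be `1 - α`, so any `c` would do;
  -- otherwise solve for `c`.
  obtain h | h := (measureReal_nonneg (μ := ν) (s := {q})).eq_or_lt
  · exact ⟨0, by simp, by rw [← h] at hge; linarith⟩
  · refine ⟨(1 - α - ν.real (Set.Ioi q)) / ν.real {q},
      ⟨div_nonneg (sub_nonneg.2 hle) h.le, (div_le_one h).2 (by linarith)⟩, ?_⟩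
    field_simp
    ring

lemma exists_mem_dualSet_integral_eq (hX : Integrable X P) {α : ℝ} (hα : α ∈ Set.Ioo 0 1) :
    ∃ Z ∈ dualSet P α, ∫ ω, X ω * Z ω ∂P = quantile P X α +
      (1 - α)⁻¹ * ∫ ω, max (X ω - quantile P X α) 0 ∂P := by
  have hm := hX.aemeasurable
  have := Measure.isProbabilityMeasure_map hm
  obtain ⟨c, hc, hmass⟩ := exists_split_atom_quantile hm hα
  set q := quantile P X α
  have hpos : 0 < 1 - α := sub_pos.2 hα.2
  let g : ℝ → ℝ := fun x ↦ (Set.Ioi q).indicator (fun _ ↦ (1 : ℝ)) x +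
    c * ({q} : Set ℝ).indicator (fun _ ↦ (1 : ℝ)) x
  have hgm : Measurable g := (measurable_const.indicator measurableSet_Ioi).add
    ((measurable_const.indicator (measurableSet_singleton q)).const_mul c)
  -- The factor `x - q` vanishes at `q`, so the choice of `c` does not disturb the last identity.
  have hg (x : ℝ) : 0 ≤ g x ∧ g x ≤ 1 ∧ (x - q) * g x = max (x - q) 0 := by
    obtain h | rfl | h := lt_trichotomy x q
    · simp [g, h.not_gt, h.ne, h.le]
    · simp [g, hc.1, hc.2]
    · simp [g, h, h.ne', h.le]
  have hgX : AEStronglyMeasurable (fun ω ↦ g (X ω)) P :=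
    (hgm.comp_aemeasurable hm).aestronglyMeasurable
  have hgi : Integrable (fun ω ↦ g (X ω)) P :=
    Integrable.of_bound hgX 1 (.of_forall fun ω ↦ by
      rw [Real.norm_of_nonneg (hg _).1]; exact (hg _).2.1)
  have hgint : ∫ ω, g (X ω) ∂P = 1 - α := by
    rw [← hmass, ← integral_map hm hgm.aestronglyMeasurable]
    simp only [g]
    rw [integral_add ((integrable_const _).indicator measurableSet_Ioi)
      (((integrable_const _).indicator (measurableSet_singleton q)).const_mul c),
      integral_const_mul, integral_indicator_const _ measurableSet_Ioi,
      integral_indicator_const _ (measurableSet_singleton q)]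
    simp
  have hZ1 : ∫ ω, (1 - α)⁻¹ * g (X ω) ∂P = 1 := by
    rw [integral_const_mul, hgint, inv_mul_cancel₀ hpos.ne']
  refine ⟨fun ω ↦ (1 - α)⁻¹ * g (X ω), ⟨hgi.const_mul _, hZ1,
    .of_forall fun ω ↦ mul_nonneg (inv_nonneg.2 hpos.le) (hg _).1, .of_forall fun ω ↦ ?_⟩, ?_⟩
  · rw [mul_inv_cancel_left₀ hpos.ne']
    exact (hg _).2.1
  · have hmax : Integrable (fun ω ↦ max (X ω - q) 0) P := (hX.sub (integrable_const q)).pos_part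
    rw [show (fun ω ↦ X ω * ((1 - α)⁻¹ * g (X ω))) = fun ω ↦
        q * ((1 - α)⁻¹ * g (X ω)) + (1 - α)⁻¹ * max (X ω - q) 0 from funext fun ω ↦ by
          rw [← (hg (X ω)).2.2]; ring,
      integral_add ((hgi.const_mul _).const_mul q) (hmax.const_mul _), integral_const_mul, hZ1,
      integral_const_mul, mul_one]

lemma ae_eq_one_of_mem_dualSet_zero {Z : Ω → ℝ} (hZ : Z ∈ dualSet P 0) : Z =ᵐ[P] 1 := by
  obtain ⟨hi, h1, -, hM⟩ := hZ
  have hle : Z ≤ᵐ[P] 1 := by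
    filter_upwards [hM] with ω hω
    simpa using hω
  exact (integral_eq_iff_of_ae_le hi (integrable_const 1) hle).1 (by simp [h1])

lemma isGreatest_cte (hX : Integrable X P) {α : ℝ} (hα0 : 0 ≤ α) (hα1 : α < 1) :
    IsGreatest {x : EReal | ∃ Z ∈ dualSet P α, x = ((∫ ω, X ω * Z ω ∂P : ℝ) : EReal)}
      (cte P α X) := by
  -- At `α = 0` the quantile may be a default value, but there `Z ≤ 1` with mean 1 forces `Z = 1`
  -- a.s.
  obtain rfl | hα := hα0.eq_or_lt
  · rw [cte_zero hX]
    refine ⟨⟨1, ⟨integrable_const 1, by simp, by simp, by simp⟩, by simp⟩, ?_⟩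
    rintro _ ⟨Z, hZ, rfl⟩
    rw [integral_congr_ae (g := X)]
    filter_upwards [ae_eq_one_of_mem_dualSet_zero hZ] with ω hω
    simp [hω]
  · rw [cte_of_pos hX ⟨hα, hα1⟩]
    constructor
    · obtain ⟨Z, hZ, h⟩ := exists_mem_dualSet_integral_eq hX ⟨hα, hα1⟩
      exact ⟨Z, hZ, by rw [h]⟩
    · rintro _ ⟨Z, hZ, rfl⟩
      exact EReal.coe_le_coe_iff.2 (integral_mul_le_of_mem_dualSet hX hα1 hZ _)

end DistortedPremium

theorem mainTheorem5 {Ω : Type*} [MeasurableSpace Ω] (P : Measure Ω) [IsProbabilityMeasure P]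
    (α : ℝ) (hα0 : 0 ≤ α) (hα1 : α < 1) (L : Ω → ℝ) (hL : Integrable L P) :
    (∀ Z ∈ DistortedPremium.dualSet P α, Integrable (fun ω => L ω * Z ω) P) ∧
    (∀ Z ∈ DistortedPremium.recursiveDualSet P α, Integrable (fun ω => L ω * Z ω) P) ∧
    DistortedPremium.cte P α L =
      sSup {x : EReal | ∃ Z ∈ DistortedPremium.dualSet P α,
        x = ((∫ ω, L ω * Z ω ∂P : ℝ) : EReal)} ∧
    DistortedPremium.cte P α L =
      sSup {x : EReal | ∃ Z ∈ DistortedPremium.recursiveDualSet P α,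
        x = ((∫ ω, L ω * Z ω ∂P : ℝ) : EReal)} := by
  have hint := fun Z ↦ DistortedPremium.integrable_mul_of_mem_dualSet (Z := Z) hL hα1
  have hsup := (DistortedPremium.isGreatest_cte hL hα0 hα1).isLUB.sSup_eq.symm
  rw [DistortedPremium.recursiveDualSet_eq_dualSet hα0 hα1]
  exact ⟨hint, hint, hsup, hsup⟩
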